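/- Let $G$ be a compact topological group whose topology is induced by a metric $d$ that is left-invariant, i.e. $d(gh_1,gh_2)=d(h_1,h_2)$ for all $g,h_1,h_2\in G$. Let $m$ be the Haar probability measure on $G$, i.e. a Borel probability measure with $m(gH)=m(H)$ for every Borel set $H\subseteq G$ and every $g\in G$. For Borel probability measures $\nu_1,\nu_2$ on $G$ let $$W(\nu_1,\nu_2)=\inf_{\gamma}\int_{G\times G} d(x_1,x_2)\,d\gamma(x_1,x_2),$$ where the infimum is over all couplings $\gamma$ of $\nu_1$ and $\nu_2$, i.e. all Borel probability measures on $G\times G$ with marginals $\nu_1$ and $\nu_2$. Let $N\ge 1$, let $Y_1,\dots,Y_N$ be independent $G$-valued random variables with law $m$, and let $m_N=\frac1N\sum_{i=1}^N\delta_{Y_i}$ be their empirical measure. Then for every Borel probability measure $\nu$ on $G$ the function $W(m_N,\nu)$ is a random variable with finite expectation, and $$m\in\operatorname*{arg\,min}_{\nu}\ \mathbb{E}[W(m_N,\nu)],$$ the minimum being over all Borel probability measures $\nu$ on $G$; that is, $\mathbb{E}[W(m_N,m)]\le\mathbb{E}[W(m_N,\nu)]$ for every such $\nu$. -/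

import Mathlib

open MeasureTheory ProbabilityTheory
open scoped ENNReal

/-- The couplings of `μ` and `ν`: measures on `X × X` with first marginal `μ` and second
marginal `ν`. -/
def couplings {X : Type*} [MeasurableSpace X] (μ ν : Measure X) : Set (Measure (X × X)) :=
  {γ | γ.fst = μ ∧ γ.snd = ν}

/-- The Wasserstein distance of order one,
`W(μ, ν) = inf_γ ∫ d(x₁, x₂) dγ(x₁, x₂)` over the couplings `γ` of `μ` and `ν`, with values in
`[0, ∞]`. -/
noncomputable def wasserstein {X : Type*} [MetricSpace X] [MeasurableSpace X]
    (μ ν : Measure X) : ℝ≥0∞ :=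
  ⨅ γ ∈ couplings μ ν, ∫⁻ p, edist p.1 p.2 ∂γ

/-- The empirical measure `N⁻¹ ∑ᵢ δ_{xᵢ}` of the points `x₁, …, x_N`. -/
noncomputable def empiricalMeasure {X : Type*} [MeasurableSpace X] {N : ℕ} (x : Fin N → X) :
    Measure X :=
  (N : ℝ≥0∞)⁻¹ • ∑ i, Measure.dirac (x i)

/-- The expected Wasserstein distance `𝔼[W(m_N, ν)]`, where `m_N` is the (random) empirical measure
of the sample `Y₁, …, Y_N`. -/
noncomputable def expectedWasserstein {Ω X : Type*} [MeasurableSpace Ω] (P : Measure Ω)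
    [MetricSpace X] [MeasurableSpace X] {N : ℕ} (Y : Fin N → Ω → X) (ν : Measure X) : ℝ≥0∞ :=
  ∫⁻ ω, wasserstein (empiricalMeasure fun i => Y i ω) ν ∂P

/-- The set `argmin_ν 𝔼[W(m_N, ν)]`, over all Borel probability measures `ν` on `X`. -/
def bestGuesses {Ω X : Type*} [MeasurableSpace Ω] (P : Measure Ω)
    [MetricSpace X] [MeasurableSpace X] {N : ℕ} (Y : Fin N → Ω → X) :
    Set (ProbabilityMeasure X) :=
  {μ | ∀ ν : ProbabilityMeasure X,
    expectedWasserstein P Y (μ : Measure X) ≤ expectedWasserstein P Y (ν : Measure X)}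

/-! Averaging the translates of ν by m-distributed g gives m, and W is convex in its second argument
and invariant under simultaneous left translation. Hence W(m_x, m) ≤ ∫ W(m_{g⁻¹x}, ν) dm(g) for
every sample x (`wasserstein_haar_le_lintegral`). Integrating over x, Tonelli and the left
invariance of mᴺ turn the right side into 𝔼[W(m_N, ν)]. Convexity under an integral needs nearly
optimal couplings chosen measurably in g. Since m_x is finitely supported, its couplings with ν
amount to decompositions of ν into N pieces, whose costs are 1-Lipschitz in x; countably many
decompositions then suffice. -/

section Decomposition

variable {X : Type*} [MeasurableSpace X] {N : ℕ}

/-- The decompositions of `ν` as an average `N⁻¹ ∑ᵢ Dᵢ` of `N` probability measures. -/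
def averageDecompositions (N : ℕ) (ν : Measure X) : Set (Fin N → Measure X) :=
  {D | (∀ i, IsProbabilityMeasure (D i)) ∧ (N : ℝ≥0∞)⁻¹ • ∑ i, D i = ν}

/-- The cost `N⁻¹ ∑ᵢ ∫ d(yᵢ, z) dDᵢ(z)` of moving the point masses at `y₁, …, y_N` to the
measures `D₁, …, D_N`. -/
noncomputable def decompositionCost [MetricSpace X] (D : Fin N → Measure X) (y : Fin N → X) :
    ℝ≥0∞ :=
  (N : ℝ≥0∞)⁻¹ * ∑ i, ∫⁻ z, edist (y i) z ∂D i

theorem lintegral_empiricalMeasure (y : Fin N → X) {f : X → ℝ≥0∞} (hf : Measurable f) :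
    ∫⁻ a, f a ∂empiricalMeasure y = (N : ℝ≥0∞)⁻¹ * ∑ i, f (y i) := by
  simp [empiricalMeasure, lintegral_finsetSum_measure, lintegral_dirac' _ hf]

theorem isProbabilityMeasure_empiricalMeasure (hN : 1 ≤ N) (y : Fin N → X) :
    IsProbabilityMeasure (empiricalMeasure y) := by
  refine ⟨?_⟩
  have hN' : (N : ℝ≥0∞) ≠ 0 := by exact_mod_cast (by omega : N ≠ 0)
  simpa using (lintegral_empiricalMeasure y (f := fun _ => 1) measurable_const).trans
    (by simp [ENNReal.inv_mul_cancel hN'])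

theorem lintegral_edist_le_add [MetricSpace X] [OpensMeasurableSpace X] (μ : Measure X)
    [IsProbabilityMeasure μ] (a b : X) :
    ∫⁻ z, edist a z ∂μ ≤ ∫⁻ z, edist b z ∂μ + edist a b := by
  calc ∫⁻ z, edist a z ∂μ ≤ ∫⁻ z, (edist b z + edist a b) ∂μ :=
        lintegral_mono fun z => by rw [add_comm]; exact edist_triangle a b z
    _ = _ := by rw [lintegral_add_right _ measurable_const]; simp

theorem decompositionCost_le_add_edist [MetricSpace X] [OpensMeasurableSpace X] (hN : 1 ≤ N)
    {D : Fin N → Measure X} (hD : ∀ i, IsProbabilityMeasure (D i)) (y y' : Fin N → X) :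
    decompositionCost D y ≤ decompositionCost D y' + edist y y' := by
  have hN' : (N : ℝ≥0∞) ≠ 0 := by exact_mod_cast (by omega : N ≠ 0)
  calc decompositionCost D y
      ≤ (N : ℝ≥0∞)⁻¹ * ∑ i, (∫⁻ z, edist (y' i) z ∂D i + edist y y') := by
        unfold decompositionCost
        gcongr with i
        exact (lintegral_edist_le_add (D i) (y i) (y' i)).trans
          (by gcongr; exact edist_le_pi_edist y y' i)
    _ = _ := by
        rw [Finset.sum_add_distrib, mul_add]
        simp [decompositionCost, ← mul_assoc, ENNReal.inv_mul_cancel hN']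

theorem wasserstein_le_decompositionCost [MetricSpace X] [SecondCountableTopology X]
    [OpensMeasurableSpace X] {ν : Measure X} {D : Fin N → Measure X}
    (hD : D ∈ averageDecompositions N ν) (y : Fin N → X) :
    wasserstein (empiricalMeasure y) ν ≤ decompositionCost D y := by
  obtain ⟨hp, hs⟩ := hD
  let γ : Measure (X × X) := (N : ℝ≥0∞)⁻¹ • ∑ i, (Measure.dirac (y i)).prod (D i)
  have hγ : γ ∈ couplings (empiricalMeasure y) ν := by
    constructor
    · ext s hs
      rw [Measure.fst_apply hs, ← Set.prod_univ]
      simp [γ, empiricalMeasure, Measure.prod_prod]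
    · rw [← hs]
      ext s hs
      rw [Measure.snd_apply hs, ← Set.univ_prod]
      simp [γ, Measure.prod_prod]
  refine (iInf₂_le γ hγ).trans_eq ?_
  simp only [γ, lintegral_smul_measure, lintegral_finsetSum_measure, decompositionCost, smul_eq_mul]
  congr 1
  refine Finset.sum_congr rfl fun i _ => ?_
  rw [lintegral_prod _ (by fun_prop)]
  exact lintegral_dirac' _ (Measurable.lintegral_prod_right (by fun_prop))

/-- Disintegrate γ over its first marginal and take the conditional law at each `y i`; repeated
points simply share a piece. -/
theorem exists_decompositionCost_eq [MetricSpace X] [SecondCountableTopology X]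
    [OpensMeasurableSpace X] [StandardBorelSpace X] (hN : 1 ≤ N) {ν : Measure X}
    {y : Fin N → X} {γ : Measure (X × X)} (hγ : γ ∈ couplings (empiricalMeasure y) ν) :
    ∃ D ∈ averageDecompositions N ν, decompositionCost D y = ∫⁻ p, edist p.1 p.2 ∂γ := by
  have : Nonempty X := ⟨y ⟨0, hN⟩⟩
  have := isProbabilityMeasure_empiricalMeasure hN y
  have : IsProbabilityMeasure γ := by
    refine ⟨?_⟩
    rw [← Measure.fst_univ, hγ.1, measure_univ]
  have hdis : empiricalMeasure y ⊗ₘ γ.condKernel = γ := by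
    rw [← hγ.1]; exact γ.disintegrate γ.condKernel
  refine ⟨fun i => γ.condKernel (y i), ⟨fun i => inferInstance, ?_⟩, ?_⟩
  · ext s hs
    have hsnd : ν = γ.condKernel ∘ₘ empiricalMeasure y := by
      rw [← hγ.2, ← Measure.snd_compProd, hdis]
    rw [hsnd, Measure.bind_apply hs (Kernel.aemeasurable _),
      lintegral_empiricalMeasure y (Kernel.measurable_coe _ hs)]
    simp
  · conv_rhs => rw [← hdis]
    rw [Measure.lintegral_compProd (by fun_prop), lintegral_empiricalMeasure y
      (Measurable.lintegral_kernel_prod_right' (f := fun p : X × X => edist p.1 p.2) (by fun_prop))]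
    rfl

theorem exists_decompositionCost_lt [MetricSpace X] [SecondCountableTopology X]
    [OpensMeasurableSpace X] [StandardBorelSpace X] (hN : 1 ≤ N) {ν : Measure X}
    {y : Fin N → X} {c : ℝ≥0∞} (h : wasserstein (empiricalMeasure y) ν < c) :
    ∃ D ∈ averageDecompositions N ν, decompositionCost D y < c := by
  simp only [wasserstein, iInf_lt_iff] at h
  obtain ⟨γ, hγ, hlt⟩ := h
  obtain ⟨D, hD, hDγ⟩ := exists_decompositionCost_eq hN hγ
  exact ⟨D, hD, hDγ ▸ hlt⟩

/-- The set of decompositions of ν does not depend on the sample, so one that is nearly optimal for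
`y'` can be reused for `y`. -/
theorem wasserstein_le_add_edist [MetricSpace X] [SecondCountableTopology X]
    [OpensMeasurableSpace X] [StandardBorelSpace X] (hN : 1 ≤ N) (ν : Measure X)
    (y y' : Fin N → X) :
    wasserstein (empiricalMeasure y) ν ≤ wasserstein (empiricalMeasure y') ν + edist y y' := by
  rw [← tsub_le_iff_right]
  refine le_of_forall_gt_imp_ge_of_dense fun c hc => ?_
  obtain ⟨D, hD, hlt⟩ := exists_decompositionCost_lt hN hc
  rw [tsub_le_iff_right]
  calc wasserstein (empiricalMeasure y) ν ≤ decompositionCost D y :=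
        wasserstein_le_decompositionCost hD y
    _ ≤ decompositionCost D y' + edist y y' := decompositionCost_le_add_edist hN hD.1 y y'
    _ ≤ c + edist y y' := by gcongr

theorem continuous_wasserstein_empiricalMeasure [MetricSpace X] [SecondCountableTopology X]
    [OpensMeasurableSpace X] [StandardBorelSpace X] (hN : 1 ≤ N) (ν : Measure X) :
    Continuous fun y : Fin N → X => wasserstein (empiricalMeasure y) ν :=
  continuous_of_le_add_edist 1 (by simp) fun y y' => by
    simpa using wasserstein_le_add_edist hN ν y y'

theorem continuous_decompositionCost [MetricSpace X] [OpensMeasurableSpace X] (hN : 1 ≤ N)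
    {D : Fin N → Measure X} (hD : ∀ i, IsProbabilityMeasure (D i)) :
    Continuous (decompositionCost D) :=
  continuous_of_le_add_edist 1 (by simp) fun y y' => by
    simpa using decompositionCost_le_add_edist hN hD y y'

theorem wasserstein_le_ediam [MetricSpace X] (μ ν : Measure X) [IsProbabilityMeasure μ]
    [IsProbabilityMeasure ν] : wasserstein μ ν ≤ Metric.ediam (Set.univ : Set X) := by
  refine (iInf₂_le (μ.prod ν) ⟨by simp, by simp⟩).trans ?_
  calc ∫⁻ p : X × X, edist p.1 p.2 ∂μ.prod ν
      ≤ ∫⁻ _, Metric.ediam (Set.univ : Set X) ∂μ.prod ν :=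
        lintegral_mono fun p => Metric.edist_le_ediam_of_mem (Set.mem_univ _) (Set.mem_univ _)
    _ = _ := by simp

theorem ediam_univ_lt_top (X : Type*) [MetricSpace X] [CompactSpace X] :
    Metric.ediam (Set.univ : Set X) < ∞ :=
  (Metric.isBounded_of_compactSpace (s := Set.univ)).ediam_ne_top.lt_top

theorem wasserstein_lt_top [MetricSpace X] [CompactSpace X] (μ ν : Measure X)
    [IsProbabilityMeasure μ] [IsProbabilityMeasure ν] : wasserstein μ ν < ∞ :=
  (wasserstein_le_ediam μ ν).trans_lt (ediam_univ_lt_top X)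

/-- Almost optimal decompositions can be chosen measurably in the sample, among countably many. -/
theorem exists_measurable_decompositionCost_le [MetricSpace X] [CompactSpace X] [BorelSpace X]
    (hN : 1 ≤ N) (ν : Measure X) [IsProbabilityMeasure ν] {ε : ℝ≥0∞} (hε : 0 < ε) :
    ∃ (D : ℕ → Fin N → Measure X) (k : (Fin N → X) → ℕ), Measurable k ∧
      (∀ n, D n ∈ averageDecompositions N ν) ∧
      ∀ y, decompositionCost (D (k y)) y ≤ wasserstein (empiricalMeasure y) ν + ε := by
  classical
  have : Nonempty X := ν.nonempty_of_neZero
  -- One δ pays for near-optimality at a dense point, the other two for moving the cost and W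
  -- between that point and `y`.
  obtain ⟨δ, hδ, hδε⟩ : ∃ δ : ℝ≥0∞, 0 < δ ∧ δ + δ + δ ≤ ε := by
    refine ⟨ε / 3, ENNReal.div_pos hε.ne' (by simp), ?_⟩
    rw [ENNReal.add_thirds]
  let u : ℕ → Fin N → X := TopologicalSpace.denseSeq _
  have hlt (n : ℕ) : wasserstein (empiricalMeasure (u n)) ν <
      wasserstein (empiricalMeasure (u n)) ν + δ := by
    have := isProbabilityMeasure_empiricalMeasure hN (u n)
    exact ENNReal.lt_add_right (wasserstein_lt_top _ _).ne hδ.ne'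
  choose D hD hDlt using fun n => exists_decompositionCost_lt hN (hlt n)
  have hex (y : Fin N → X) :
      ∃ n, decompositionCost (D n) y ≤ wasserstein (empiricalMeasure y) ν + ε := by
    obtain ⟨_, ⟨n, rfl⟩, hn⟩ := EMetric.mem_closure_iff.1
      (TopologicalSpace.denseRange_denseSeq (Fin N → X) y) δ hδ
    refine ⟨n, ?_⟩
    calc decompositionCost (D n) y
        ≤ decompositionCost (D n) (u n) + edist y (u n) :=
          decompositionCost_le_add_edist hN (hD n).1 _ _
      _ ≤ (wasserstein (empiricalMeasure (u n)) ν + δ) + δ := by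
          gcongr
          exact (hDlt n).le
      _ ≤ ((wasserstein (empiricalMeasure y) ν + δ) + δ) + δ := by
          gcongr
          refine (wasserstein_le_add_edist hN ν (u n) y).trans ?_
          rw [edist_comm]
          gcongr
      _ = wasserstein (empiricalMeasure y) ν + (δ + δ + δ) := by ring
      _ ≤ _ := by gcongr
  -- Taking the least admissible index makes the choice measurable.
  refine ⟨D, fun y => Nat.find (hex y), ?_, hD, fun y => Nat.find_spec (hex y)⟩
  refine measurable_find hex fun n => measurableSet_le ?_ ?_
  · exact (continuous_decompositionCost hN (hD n).1).measurable
  · exact ((continuous_wasserstein_empiricalMeasure hN ν).measurable).add_const ε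

theorem expectedWasserstein_eq_lintegral_pi {X : Type*} [MetricSpace X] [SecondCountableTopology X]
    [MeasurableSpace X] [BorelSpace X] [StandardBorelSpace X] {m : Measure X} (ν : Measure X) {N : ℕ} (hN : 1 ≤ N)
    {Ω : Type*} [MeasurableSpace Ω] {P : Measure Ω} [IsProbabilityMeasure P]
    {Y : Fin N → Ω → X} (hY : ∀ i, Measurable (Y i)) (hindep : iIndepFun Y P)
    (hlaw : ∀ i, P.map (Y i) = m) :
    expectedWasserstein P Y ν =
      ∫⁻ x, wasserstein (empiricalMeasure x) ν ∂Measure.pi fun _ : Fin N => m := by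
  have hmap := (iIndepFun_iff_map_fun_eq_pi_map fun i => (hY i).aemeasurable).1 hindep
  simp only [hlaw] at hmap
  rw [← hmap, lintegral_map (continuous_wasserstein_empiricalMeasure hN ν).measurable
    (by fun_prop)]
  rfl

end Decomposition

section CompactGroup

variable {G : Type*} [Group G] [MetricSpace G] [IsTopologicalGroup G] [CompactSpace G]
  [MeasurableSpace G] [BorelSpace G]

/-- A right translate of m is again left-invariant, so it is a multiple of m by uniqueness of Haar
measure; total mass forces the factor 1. -/
theorem isMulRightInvariant_of_isMulLeftInvariant (m : Measure G) [IsProbabilityMeasure m]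
    [m.IsMulLeftInvariant] : m.IsMulRightInvariant := by
  refine ⟨fun h => ?_⟩
  have : IsProbabilityMeasure (m.map (· * h)) :=
    Measure.isProbabilityMeasure_map (by fun_prop)
  have : (m.map (· * h)).IsMulLeftInvariant := inferInstance
  have hm : m.IsHaarMeasure := Measure.isHaarMeasure_of_isCompact_nonempty_interior m Set.univ
    isCompact_univ (by simp) (by simp) (by simp)
  have key := Measure.isMulInvariant_eq_smul_of_compactSpace (m.map (· * h)) m
  have huniv := congrArg (fun μ : Measure G => μ Set.univ) key
  simp only [Measure.smul_apply, measure_univ] at huniv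
  have hc : Measure.haarScalarFactor (m.map (· * h)) m = 1 := by
    rw [ENNReal.smul_def] at huniv
    simpa using huniv.symm
  rw [key, hc, one_smul]

/-- This is m ∗ ν = m: after Tonelli, the inner integral is the m-measure of a right translate of
`s`. -/
theorem lintegral_measure_preimage_mul_left (m : Measure G) [IsProbabilityMeasure m]
    [m.IsMulLeftInvariant] (ν : Measure G) [IsProbabilityMeasure ν] {s : Set G}
    (hs : MeasurableSet s) : ∫⁻ g, ν ((g * ·) ⁻¹' s) ∂m = m s := by
  have := isMulRightInvariant_of_isMulLeftInvariant m
  have hmul : MeasurableSet ((fun p : G × G => p.1 * p.2) ⁻¹' s) :=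
    hs.preimage (by fun_prop)
  calc ∫⁻ g, ν ((g * ·) ⁻¹' s) ∂m
      = m.prod ν ((fun p : G × G => p.1 * p.2) ⁻¹' s) := (Measure.prod_apply hmul).symm
    _ = ∫⁻ h, m ((· * h) ⁻¹' s) ∂ν := Measure.prod_apply_symm hmul
    _ = m s := by simp [measure_preimage_mul_right]

/-- Averaging a coupling over all left translations moves `ν` to the Haar measure. -/
theorem wasserstein_haar_le_lintegral
    (hd : ∀ g h₁ h₂ : G, dist (g * h₁) (g * h₂) = dist h₁ h₂)
    (m : Measure G) [IsProbabilityMeasure m] [m.IsMulLeftInvariant]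
    (ν : Measure G) [IsProbabilityMeasure ν] {N : ℕ} (hN : 1 ≤ N) (x : Fin N → G) :
    wasserstein (empiricalMeasure x) m ≤
      ∫⁻ g, wasserstein (empiricalMeasure fun i => g⁻¹ * x i) ν ∂m := by
  refine ENNReal.le_of_forall_pos_le_add fun ε hε _ => ?_
  obtain ⟨D, k, hk, hD, hDk⟩ := exists_measurable_decompositionCost_le hN ν
    (ENNReal.coe_pos.2 hε)
  have hshift : Measurable fun g : G => fun i => g⁻¹ * x i := by fun_prop
  let κ (i : Fin N) : Kernel G G :=
    ⟨fun g => D (k fun i => g⁻¹ * x i) i,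
      (measurable_from_nat (f := fun n => D n i)).comp (hk.comp hshift)⟩
  have hκ (i : Fin N) : IsMarkovKernel (κ i) := ⟨fun g => (hD _).1 i⟩
  let T : G × G → G := fun p => p.1 * p.2
  have hT : Measurable T := by fun_prop
  -- `E i` is the law of g·z with g drawn from m and z from the i-th piece chosen for the sample
  -- g⁻¹x.
  let E (i : Fin N) : Measure G := (m ⊗ₘ κ i).map T
  have hE : E ∈ averageDecompositions N m := by
    refine ⟨fun i => Measure.isProbabilityMeasure_map hT.aemeasurable, ?_⟩
    ext s hs
    have hEs (i : Fin N) : E i s = ∫⁻ g, κ i g ((g * ·) ⁻¹' s) ∂m := by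
      rw [Measure.map_apply hT hs, Measure.compProd_apply (hT hs)]
      rfl
    have hmeas (i : Fin N) : Measurable fun g => κ i g ((g * ·) ⁻¹' s) :=
      Kernel.measurable_kernel_prodMk_left (hT hs)
    rw [← lintegral_measure_preimage_mul_left m ν hs, Measure.smul_apply,
      Measure.finsetSum_apply, smul_eq_mul]
    simp_rw [hEs]
    rw [← lintegral_finsetSum _ fun i _ => hmeas i,
      ← lintegral_const_mul _ (Finset.measurable_sum _ fun i _ => hmeas i)]
    refine lintegral_congr fun g => ?_
    rw [← (hD (k fun i => g⁻¹ * x i)).2, Measure.smul_apply, Measure.finsetSum_apply, smul_eq_mul]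
    rfl
  have hedist (g a b : G) : edist a (g * b) = edist (g⁻¹ * a) b := by
    rw [edist_dist, edist_dist, ← hd g (g⁻¹ * a) b, mul_inv_cancel_left]
  have hcost (i : Fin N) :
      ∫⁻ z, edist (x i) z ∂E i = ∫⁻ g, ∫⁻ z, edist (g⁻¹ * x i) z ∂κ i g ∂m := by
    rw [lintegral_map (by fun_prop) hT, Measure.lintegral_compProd (by fun_prop)]
    simp only [T, hedist]
  have hmeas (i : Fin N) : Measurable fun g => ∫⁻ z, edist (g⁻¹ * x i) z ∂κ i g :=
    Measurable.lintegral_kernel_prod_right' (f := fun p : G × G => edist (p.1⁻¹ * x i) p.2)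
      (by fun_prop)
  calc wasserstein (empiricalMeasure x) m ≤ decompositionCost E x :=
        wasserstein_le_decompositionCost hE x
    _ = ∫⁻ g, decompositionCost (D (k fun i => g⁻¹ * x i)) (fun i => g⁻¹ * x i) ∂m := by
        simp_rw [decompositionCost, hcost]
        rw [← lintegral_finsetSum _ fun i _ => hmeas i,
          ← lintegral_const_mul _ (Finset.measurable_sum _ fun i _ => hmeas i)]
        rfl
    _ ≤ ∫⁻ g, (wasserstein (empiricalMeasure fun i => g⁻¹ * x i) ν + ε) ∂m :=
        lintegral_mono fun g => hDk _
    _ = _ := by rw [lintegral_add_right _ measurable_const]; simp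

end CompactGroup

theorem theorem6p1 {G : Type*} [Group G] [MetricSpace G] [IsTopologicalGroup G] [CompactSpace G]
    [MeasurableSpace G] [BorelSpace G]
    (hd : ∀ g h₁ h₂ : G, dist (g * h₁) (g * h₂) = dist h₁ h₂)
    (m : ProbabilityMeasure G) (hm : (m : Measure G).IsMulLeftInvariant)
    (N : ℕ) (hN : 1 ≤ N)
    {Ω : Type*} [MeasurableSpace Ω] (P : Measure Ω) [IsProbabilityMeasure P]
    (Y : Fin N → Ω → G) (hY : ∀ i, Measurable (Y i)) (hindep : iIndepFun Y P)
    (hlaw : ∀ i, P.map (Y i) = (m : Measure G)) :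
    (∀ ν : ProbabilityMeasure G,
      Measurable (fun ω => wasserstein (empiricalMeasure fun i => Y i ω) (ν : Measure G)) ∧
      expectedWasserstein P Y (ν : Measure G) < ∞) ∧
    m ∈ bestGuesses P Y := by
  refine ⟨fun ν => ⟨?_, ?_⟩, fun ν => ?_⟩
  · exact (continuous_wasserstein_empiricalMeasure hN (ν : Measure G)).measurable.comp
      (measurable_pi_lambda _ hY)
  · calc expectedWasserstein P Y (ν : Measure G)
        ≤ ∫⁻ _, Metric.ediam (Set.univ : Set G) ∂P := lintegral_mono fun ω => by
          have := isProbabilityMeasure_empiricalMeasure hN fun i => Y i ω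
          exact wasserstein_le_ediam _ _
      _ < ∞ := by simpa using ediam_univ_lt_top G
  · rw [expectedWasserstein_eq_lintegral_pi _ hN hY hindep hlaw,
      expectedWasserstein_eq_lintegral_pi _ hN hY hindep hlaw]
    have hW := (continuous_wasserstein_empiricalMeasure hN (ν : Measure G)).measurable
    calc ∫⁻ x, wasserstein (empiricalMeasure x) (m : Measure G)
          ∂Measure.pi (fun _ : Fin N => (m : Measure G))
        ≤ ∫⁻ x, ∫⁻ g, wasserstein (empiricalMeasure fun i => g⁻¹ * x i) (ν : Measure G) ∂m
            ∂Measure.pi (fun _ : Fin N => (m : Measure G)) :=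
          lintegral_mono fun x => wasserstein_haar_le_lintegral hd m ν hN x
      _ = ∫⁻ g, ∫⁻ x, wasserstein (empiricalMeasure fun i => g⁻¹ * x i) (ν : Measure G)
            ∂Measure.pi (fun _ : Fin N => (m : Measure G)) ∂m :=
          lintegral_lintegral_swap
            (hW.comp (g := fun y : Fin N → G => wasserstein (empiricalMeasure y) (ν : Measure G))
              (f := fun p : (Fin N → G) × G => fun i => p.2⁻¹ * p.1 i)
              (by fun_prop)).aemeasurable
      _ = ∫⁻ _ : G, ∫⁻ x, wasserstein (empiricalMeasure x) (ν : Measure G)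
            ∂Measure.pi (fun _ : Fin N => (m : Measure G)) ∂m :=
          lintegral_congr fun g =>
            (measurePreserving_pi _ _ fun _ : Fin N =>
              measurePreserving_mul_left (m : Measure G) g⁻¹).lintegral_comp hW
      _ = _ := by simp
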